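/- Let $K$ be a total computable function from binary strings to natural numbers such that $\sum_x 2^{-K(x)}\le 1$, where the sum is over all binary strings $x$ (including the empty one). Then there exists an oracle machine $M$ with the following property: for every infinite bit sequence $\alpha$ there exists an infinite bit sequence $\beta$ such that $M$ computes $\alpha$ with oracle $\beta$, and for every $n\ge 0$ the oracle use when computing the prefix $\alpha\upharpoonright n$ (the first $n$ bits of $\alpha$) is at most $K(\alpha\upharpoonright n)$. Here an oracle machine has an input tape on which an infinite bit sequence $\beta$ (the oracle) is written. Starting from a fixed initial memory content, and as prescribed by a computable program, at each step the machine performs an internal computation on its memory, or reads the next bit of the input tape, or writes the next bit of the output sequence. The machine computes $\alpha$ with oracle $\beta$ if the output sequence that it produces is the infinite sequence $\alpha$. The oracle use for the prefix $\alpha\upharpoonright n$ is the number of bits of $\beta$ that the machine has read at the (first) moment when $n$ output bits have been produced. -/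

import Mathlib

/-- An oracle machine with a one-way, read-only oracle tape and a one-way, write-only output tape.
The internal memory of the machine (everything except the two tapes) is coded by a natural number.
The computable function `instr` is the program: depending on the current memory `q`, the machine
performs one of the following actions.
* `instr q = inl q'`: an internal computation step, the new memory is `q'`
  (the machine has stopped if `q' = q`);
* `instr q = inr (inl (q₀, q₁))`: read the next bit of the oracle tape,
  the new memory is `q₀` if this bit is `0`, and `q₁` if this bit is `1`;
* `instr q = inr (inr (b, q'))`: write the bit `b` on the output tape, the new memory is `q'`.

Bit sequences are functions `ℕ → Bool`, where `false` is the bit `0` and `true` the bit `1`. -/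
structure OracleMachine where
  start : ℕ
  instr : ℕ → ℕ ⊕ ((ℕ × ℕ) ⊕ (Bool × ℕ))
  computable_instr : Computable instr

namespace OracleMachine

/-- A configuration: the internal memory, the number of oracle bits that have been read so far
(so the next bit to be read is the one at this index), and the bits that have been written so
far, in the order in which they were written. -/
structure Config where
  memory : ℕ
  bitsRead : ℕ
  output : List Bool

/-- One step of the machine `M` with oracle `β`. -/
def step (M : OracleMachine) (β : ℕ → Bool) (c : Config) : Config :=
  match M.instr c.memory with
  | Sum.inl q => ⟨q, c.bitsRead, c.output⟩
  | Sum.inr (Sum.inl (q₀, q₁)) =>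
      ⟨if β c.bitsRead then q₁ else q₀, c.bitsRead + 1, c.output⟩
  | Sum.inr (Sum.inr (b, q)) => ⟨q, c.bitsRead, c.output ++ [b]⟩

/-- The configuration of the machine `M` with oracle `β` after `t` steps. -/
def run (M : OracleMachine) (β : ℕ → Bool) : ℕ → Config
  | 0 => ⟨M.start, 0, []⟩
  | t + 1 => M.step β (M.run β t)

end OracleMachine

/-- The prefix of length `n` of the bit sequence `α`. -/
def bitPrefix (α : ℕ → Bool) (n : ℕ) : List Bool :=
  (List.range n).map α

namespace OracleMachine

/-- The machine `M` computes the infinite bit sequence `α` with oracle `β`: the output produced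
is the whole sequence `α`. (The output only changes by appending one bit at a time.) -/
def Computes (M : OracleMachine) (β α : ℕ → Bool) : Prop :=
  ∀ n : ℕ, ∃ t : ℕ, (M.run β t).output = bitPrefix α n

/-- With oracle `β`, the machine `M` has read exactly `k` bits of the oracle at the first moment
when `n` output bits have been produced (in particular, such a moment exists). -/
def HasOracleUse (M : OracleMachine) (β : ℕ → Bool) (n k : ℕ) : Prop :=
  ∃ t : ℕ, IsLeast {s : ℕ | n ≤ (M.run β s).output.length} t ∧ (M.run β t).bitsRead = k

end OracleMachine

/-! Strings are stored backwards, so prefixes become suffixes and the complexity is `κ x = K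
x.reverse`. The oracle space is partitioned into finitely many cylinders, the cells, each owned by a
string; at first the empty string owns everything. When `x` is processed, a cell of a proper
ancestor is sought that has measure at least `2^(-κ y)` for every `y` strictly below the owner on
the path to `x`. Among such cells the smallest is taken, with the nearest owner in case of a tie. It
is cut along a path of zeros: `x` gets a cylinder of measure `2^(-κ x)`, and each piece cut off goes
to the nearest ancestor `y` with `2^(-κ y)` larger than the piece, or else stays with the old owner.
Hence for each `z` strictly below the owner on this path, the pieces given to extensions of `z` form
exactly one cylinder, with address length at most `κ z` (`exists_block`).

The search never fails. The choice rule keeps the cells of one owner of distinct lengths, and the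
mass of a nonempty owner `z` at most `2^(-κ z)` (`CellInvariant.allocate`,
`CellInvariant.sum_owner_le`). If `x` found no cell, every proper ancestor would own less than
`2^(-κ y)` for some `y` below it on the path to `x`. Shifting along the path then makes the total
mass, which is 1, smaller than a finite sum of terms `2^(-κ y)`, which is at most 1
(`CellInvariant.exists_eligible`).

By compactness some `β` runs through a block of every nonempty prefix of `α` (`exists_oracle`). The
decoder replays the allocation, writes a bit as soon as all cells compatible with the bits read
agree on it, and reads only if some compatible cell belongs to a proper extension of the output.
Such a read never goes beyond the block of a longer prefix (`lt_of_undecided`), which bounds the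
oracle use. -/

open Encodable

/-! ### Cells and the allocation rule -/

/-- A cell `(owner, address)`; both strings are stored with the most recent bit first. -/
abbrev Cell := List Bool × List Bool

def gap (x : List Bool) (c : Cell) : ℕ := x.length - c.1.length

/-- The cell `c` belongs to a proper ancestor of `x` and is large enough to be handed down to `x`
through all intermediate ancestors; `k j` is the complexity of the ancestor `x.drop j`. -/
def Eligible (k : ℕ → ℕ) (x : List Bool) (c : Cell) : Prop :=
  c.1.length < x.length ∧ x.drop (gap x c) = c.1 ∧ ∀ j < gap x c, c.2.length ≤ k j

/-- Lexicographic order in one number: a longer address wins, then a longer owner. Owners of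
eligible cells are shorter than `x`, so the second component never overflows. -/
def cellKey (x : List Bool) (c : Cell) : ℕ := c.2.length * (x.length + 1) + c.1.length

def Best (k : ℕ → ℕ) (x : List Bool) (L : List Cell) (c : Cell) : Prop :=
  Eligible k x c ∧ ∀ d ∈ L, ¬ Eligible k x d ∨ cellKey x d ≤ cellKey x c

/-- If no index below `i` qualifies, `findIdx` returns `i`; with `i = gap x c` the piece then stays
with the owner of `c`. -/
def ownerAt (k : ℕ → ℕ) (x : List Bool) (i l : ℕ) : List Bool :=
  x.drop ((List.range i).findIdx fun j => decide (k j < l))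

/-- The cells into which `c` is cut when it is used for `x`. -/
def pieces (k : ℕ → ℕ) (x : List Bool) (c : Cell) : List Cell :=
  (x, List.replicate (k 0 - c.2.length) false ++ c.2) ::
    (List.range (k 0 - c.2.length)).map fun j =>
      (ownerAt k x (gap x c) (c.2.length + j + 1), true :: (List.replicate j false ++ c.2))

open Classical in
noncomputable def allocate (k : ℕ → ℕ) (x : List Bool) (L : List Cell) : List Cell :=
  L.flatMap fun d => if Best k x L d then pieces k x d else [d]

/-- `decode₂` accepts only genuine codes, so each nonempty string has exactly one stage. The default
`[]` is harmless: it has no proper ancestor, hence no eligible cell. -/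
def stage (n : ℕ) : List Bool := (decode₂ (List Bool) n).getD []

noncomputable def cells (κ : List Bool → ℕ) : ℕ → List Cell
  | 0 => [([], [])]
  | n + 1 => allocate (fun j => κ ((stage n).drop j)) (stage n) (cells κ n)

/-! ### Computability of the allocation -/

section Computability

variable {α β σ : Type*} [Primcodable α] [Primcodable β] [Primcodable σ]

theorem PrimrecPred.forall_mem_of {f : α → List β} {p : α → β → Prop} (hf : Primrec f)
    (hp : PrimrecPred fun q : α × β => p q.1 q.2) : PrimrecPred fun a => ∀ b ∈ f a, p a b := by
  have h : PrimrecRel fun (b : β) (a : α) => p a b :=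
    PrimrecPred.primrecRel (hp.comp (Primrec.pair Primrec.snd Primrec.fst))
  exact h.forall_mem_list.comp hf Primrec.id

theorem PrimrecPred.exists_mem_of {f : α → List β} {p : α → β → Prop} (hf : Primrec f)
    (hp : PrimrecPred fun q : α × β => p q.1 q.2) : PrimrecPred fun a => ∃ b ∈ f a, p a b := by
  have h : PrimrecRel fun (b : β) (a : α) => p a b :=
    PrimrecPred.primrecRel (hp.comp (Primrec.pair Primrec.snd Primrec.fst))
  exact h.exists_mem_list.comp hf Primrec.id

theorem PrimrecPred.forall_lt_of {f : α → ℕ} {p : α → ℕ → Prop} (hf : Primrec f)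
    (hp : PrimrecPred fun q : α × ℕ => p q.1 q.2) : PrimrecPred fun a => ∀ j < f a, p a j :=
  (PrimrecPred.forall_mem_of (Primrec.list_range.comp hf) hp).of_eq fun a => by simp

theorem Primrec.list_replicate {f : α → ℕ} {g : α → σ} (hf : Primrec f) (hg : Primrec g) :
    Primrec fun a => List.replicate (f a) (g a) :=
  (Primrec.list_map (Primrec.list_range.comp hf) (hg.comp Primrec.fst).to₂).of_eq fun a => by
    simp

theorem PrimrecPred.suffix_of {γ : Type*} [Primcodable γ] {f g : α → List γ} (hf : Primrec f)
    (hg : Primrec g) : PrimrecPred fun a => f a <:+ g a :=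
  (Primrec.eq.comp hf (Primrec.list_drop.comp (Primrec.nat_sub.comp (Primrec.list_length.comp hg)
    (Primrec.list_length.comp hf)) hg)).of_eq fun _ => List.suffix_iff_eq_drop.symm

theorem Computable.list_map_range {f : α → ℕ → σ} {g : α → ℕ} (hf : Computable₂ f)
    (hg : Computable g) : Computable fun a => (List.range (g a)).map (f a) :=
  (Computable.nat_rec hg (Computable.const [])
    (Computable.list_concat.comp (Computable.snd.comp Computable.snd)
      (hf.comp Computable.fst (Computable.fst.comp Computable.snd))).to₂).of_eq fun a => by
    induction g a <;> simp_all [List.range_succ]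

section

variable {d : ℕ} {T : α → List ℕ} {x : α → List Bool} {c : α → Cell} {L : α → List Cell}

theorem primrec_gap (hx : Primrec x) (hc : Primrec c) : Primrec fun a => gap (x a) (c a) :=
  Primrec.nat_sub.comp (Primrec.list_length.comp hx)
    (Primrec.list_length.comp (Primrec.fst.comp hc))

theorem primrec_cellKey (hx : Primrec x) (hc : Primrec c) :
    Primrec fun a => cellKey (x a) (c a) :=
  Primrec.nat_add.comp (Primrec.nat_mul.comp (Primrec.list_length.comp (Primrec.snd.comp hc))
    (Primrec.succ.comp (Primrec.list_length.comp hx)))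
    (Primrec.list_length.comp (Primrec.fst.comp hc))

theorem primrecPred_eligible (hT : Primrec T) (hx : Primrec x) (hc : Primrec c) :
    PrimrecPred fun a => Eligible (fun j => (T a).getD j d) (x a) (c a) := by
  refine PrimrecPred.and (Primrec.nat_lt.comp (Primrec.list_length.comp (Primrec.fst.comp hc))
    (Primrec.list_length.comp hx)) (PrimrecPred.and ?_ ?_)
  · exact Primrec.eq.comp (Primrec.list_drop.comp (primrec_gap hx hc) hx) (Primrec.fst.comp hc)
  · exact PrimrecPred.forall_lt_of (primrec_gap hx hc)
      (Primrec.nat_le.comp (Primrec.list_length.comp (Primrec.snd.comp (hc.comp Primrec.fst)))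
        ((Primrec.list_getD d).comp (hT.comp Primrec.fst) Primrec.snd))

theorem primrecPred_best (hT : Primrec T) (hx : Primrec x) (hL : Primrec L) (hc : Primrec c) :
    PrimrecPred fun a => Best (fun j => (T a).getD j d) (x a) (L a) (c a) := by
  refine PrimrecPred.and (primrecPred_eligible hT hx hc) (PrimrecPred.forall_mem_of hL
    (PrimrecPred.or (PrimrecPred.not (primrecPred_eligible (hT.comp Primrec.fst)
      (hx.comp Primrec.fst) Primrec.snd)) ?_))
  exact Primrec.nat_le.comp (primrec_cellKey (hx.comp Primrec.fst) Primrec.snd)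
    (primrec_cellKey (hx.comp Primrec.fst) (hc.comp Primrec.fst))

theorem primrec_ownerAt {i l : α → ℕ} (hT : Primrec T) (hx : Primrec x) (hi : Primrec i)
    (hl : Primrec l) :
    Primrec fun a => ownerAt (fun j => (T a).getD j d) (x a) (i a) (l a) := by
  refine Primrec.list_drop.comp (Primrec.list_findIdx (Primrec.list_range.comp hi) ?_) hx
  have : PrimrecPred fun q : α × ℕ => (T q.1).getD q.2 d < l q.1 :=
    Primrec.nat_lt.comp ((Primrec.list_getD d).comp (hT.comp Primrec.fst) Primrec.snd)
      (hl.comp Primrec.fst)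
  exact this.decide

theorem primrec_pieces (hT : Primrec T) (hx : Primrec x) (hc : Primrec c) :
    Primrec fun a => pieces (fun j => (T a).getD j d) (x a) (c a) := by
  have hlen : Primrec fun a => (c a).2.length := Primrec.list_length.comp (Primrec.snd.comp hc)
  have hn : Primrec fun a => (T a).getD 0 d - (c a).2.length :=
    Primrec.nat_sub.comp ((Primrec.list_getD d).comp hT (Primrec.const 0)) hlen
  refine Primrec.list_cons.comp (Primrec.pair hx (Primrec.list_append.comp
    (Primrec.list_replicate hn (Primrec.const false)) (Primrec.snd.comp hc)))
    (Primrec.list_map (Primrec.list_range.comp hn) (Primrec₂.mk (Primrec.pair ?_ ?_)))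
  · exact primrec_ownerAt (hT.comp Primrec.fst) (hx.comp Primrec.fst)
      (primrec_gap (hx.comp Primrec.fst) (hc.comp Primrec.fst))
      (Primrec.succ.comp (Primrec.nat_add.comp (hlen.comp Primrec.fst) Primrec.snd))
  · exact Primrec.list_cons.comp (Primrec.const true) (Primrec.list_append.comp
      (Primrec.list_replicate Primrec.snd (Primrec.const false))
      (Primrec.snd.comp (hc.comp Primrec.fst)))

theorem primrec_allocate (hT : Primrec T) (hx : Primrec x) (hL : Primrec L) :
    Primrec fun a => allocate (fun j => (T a).getD j d) (x a) (L a) := by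
  classical
  refine Primrec.list_flatMap hL (Primrec₂.mk ?_)
  exact Primrec.ite (primrecPred_best (hT.comp Primrec.fst)
    (hx.comp Primrec.fst) (hL.comp Primrec.fst) Primrec.snd)
    (primrec_pieces (hT.comp Primrec.fst) (hx.comp Primrec.fst) Primrec.snd)
    (Primrec.list_cons.comp Primrec.snd (Primrec.const []))

end

theorem primrec_stage : Primrec stage :=
  Primrec.option_getD.comp Primrec.decode₂ (Primrec.const [])

theorem computable_cells {κ : List Bool → ℕ} (hκ : Computable κ) : Computable (cells κ) := by
  have hT : Computable fun n : ℕ =>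
      (List.range ((stage n).length + 1)).map fun j => κ ((stage n).drop j) :=
    Computable.list_map_range
      (hκ.comp (Primrec.list_drop.comp Primrec.snd
        (primrec_stage.comp Primrec.fst)).to_comp).to₂
      (Primrec.succ.comp (Primrec.list_length.comp primrec_stage)).to_comp
  -- One stage is primitive recursive in a finite table of complexities. Dropping past the end of a
  -- string leaves `[]`, so `κ []` is the correct default outside the table.
  have hstep : Primrec fun q : List ℕ × List Bool × List Cell =>
      allocate (fun j => q.1.getD j (κ [])) q.2.1 q.2.2 :=
    primrec_allocate Primrec.fst (Primrec.fst.comp Primrec.snd) (Primrec.snd.comp Primrec.snd)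
  refine (Computable.nat_rec (f := fun n : ℕ => n) (g := fun _ => [(([], []) : Cell)])
    (h := fun _ (q : ℕ × List Cell) => allocate
      (fun j => ((List.range ((stage q.1).length + 1)).map
        fun j => κ ((stage q.1).drop j)).getD j (κ [])) (stage q.1) q.2)
    Computable.id (Computable.const _)
    (hstep.to_comp.comp (Computable.pair (hT.comp (Computable.fst.comp Computable.snd))
      (Computable.pair (primrec_stage.to_comp.comp (Computable.fst.comp Computable.snd))
        (Computable.snd.comp Computable.snd)))).to₂).of_eq fun n => ?_
  induction n with
  | zero => rfl
  | succ n ih =>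
    simp only [cells]
    rw [← ih]
    congr 1
    funext j
    simp only [List.getD_eq_getElem?_getD, List.getElem?_map]
    by_cases h : j < (stage n).length + 1
    · simp [List.getElem?_range h]
    · have h' : (stage n).length ≤ j := by omega
      have h'' : (List.range ((stage n).length + 1))[j]? = none :=
        List.getElem?_eq_none (by simp; omega)
      simp [List.drop_eq_nil_of_le h', h'']

end Computability

/-! ### Comparing addresses -/

section Suffix

theorem suffix_append_right_iff {a b p : List Bool} : a ++ p <:+ b ++ p ↔ a <:+ b := by
  constructor
  · rintro ⟨t, ht⟩
    exact ⟨t, List.append_cancel_right (by simpa using ht)⟩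
  · rintro ⟨t, rfl⟩
    exact ⟨t, by simp⟩

theorem replicate_append_suffix_iff {m j : ℕ} {p : List Bool} :
    List.replicate m false ++ p <:+ true :: (List.replicate j false ++ p) ↔ m ≤ j := by
  rw [← List.cons_append, suffix_append_right_iff, List.suffix_cons_iff]
  constructor
  · rintro (h | h)
    · have : true ∈ List.replicate m false := h ▸ List.mem_cons_self
      simp at this
    · simpa using h.length_le
  · intro h
    exact Or.inr ⟨List.replicate (j - m) false, by simp [h]⟩

theorem not_true_cons_suffix_replicate {m j : ℕ} {p : List Bool} :
    ¬ true :: (List.replicate j false ++ p) <:+ List.replicate m false ++ p := by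
  rw [← List.cons_append, suffix_append_right_iff]
  intro h
  have := h.subset List.mem_cons_self
  simp at this

theorem true_cons_suffix_true_cons {i j : ℕ} {p : List Bool}
    (h : true :: (List.replicate i false ++ p) <:+ true :: (List.replicate j false ++ p)) :
    i = j := by
  rcases List.suffix_cons_iff.1 h with h | h
  · have := congrArg List.length h
    simpa using this
  · exact absurd h not_true_cons_suffix_replicate

theorem suffix_or_suffix {a b c : List Bool} (ha : a <:+ c) (hb : b <:+ c) :
    a <:+ b ∨ b <:+ a :=
  List.suffix_or_suffix_of_suffix ha hb

/-- Ancestors have smaller codes, so no string owns a cell before its own stage. -/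
theorem encode_le_of_suffix {a b : List Bool} (h : a <:+ b) : encode a ≤ encode b := by
  obtain ⟨t, rfl⟩ := h
  induction t with
  | nil => simp
  | cons u t ih =>
    rw [List.cons_append, Encodable.encode_list_cons]
    exact ih.trans ((Nat.right_le_pair _ _).trans (Nat.le_succ _))

end Suffix

/-! ### Cutting one cell -/

section Pieces

variable {k : ℕ → ℕ} {x : List Bool} {c d e : Cell} {L : List Cell}

theorem ownerAt_spec (k : ℕ → ℕ) (x : List Bool) (i l : ℕ) :
    ∃ j ≤ i, ownerAt k x i l = x.drop j ∧ (∀ j' < j, l ≤ k j') ∧ (j < i → k j < l) := by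
  refine ⟨(List.range i).findIdx fun j => decide (k j < l), ?_, rfl, ?_, ?_⟩
  · simpa using List.findIdx_le_length (xs := List.range i) (p := fun j => decide (k j < l))
  · intro j' hj'
    simpa using List.not_of_lt_findIdx hj'
  · intro h
    have := List.findIdx_getElem (xs := List.range i) (p := fun j => decide (k j < l))
      (w := by simpa using h)
    rw [List.getElem_range] at this
    simpa using this

theorem Eligible.gap_pos (h : Eligible k x c) : 0 < gap x c := Nat.sub_pos_of_lt h.1

theorem Eligible.length_le (h : Eligible k x c) : c.2.length ≤ k 0 := h.2.2 0 h.gap_pos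

theorem gap_le : gap x c ≤ x.length := Nat.sub_le _ _

theorem Eligible.length_owner (h : Eligible k x c) : c.1.length + gap x c = x.length := by
  have := h.1
  unfold gap
  omega

theorem mem_pieces : d ∈ pieces k x c ↔
    d = (x, List.replicate (k 0 - c.2.length) false ++ c.2) ∨ ∃ j < k 0 - c.2.length,
      d = (ownerAt k x (gap x c) (c.2.length + j + 1),
        true :: (List.replicate j false ++ c.2)) := by
  simp [pieces, eq_comm]

theorem address_suffix_of_mem_pieces (h : d ∈ pieces k x c) : c.2 <:+ d.2 := by
  rcases mem_pieces.1 h with rfl | ⟨j, -, rfl⟩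
  · exact List.suffix_append _ _
  · exact (List.suffix_append _ _).trans (List.suffix_cons _ _)

theorem eq_of_mem_pieces_of_suffix (hd : d ∈ pieces k x c) (he : e ∈ pieces k x c)
    (h : d.2 <:+ e.2) : d = e := by
  rcases mem_pieces.1 hd with rfl | ⟨i, hi, rfl⟩ <;> rcases mem_pieces.1 he with rfl | ⟨j, hj, rfl⟩
  · rfl
  · have := replicate_append_suffix_iff.1 h
    omega
  · exact absurd h not_true_cons_suffix_replicate
  · rw [true_cons_suffix_true_cons h]

/-- The owners of the pieces: either `x` itself or the deepest ancestor whose complexity is below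
the length of the address. -/
theorem owner_of_mem_pieces (hc : Eligible k x c) (hd : d ∈ pieces k x c) :
    (d.1 = x ∧ d.2.length = k 0) ∨
      ∃ j, 0 < j ∧ j ≤ gap x c ∧ d.1 = x.drop j ∧ c.2.length < d.2.length ∧
        (∀ j' < j, d.2.length ≤ k j') ∧ (j < gap x c → k j < d.2.length) := by
  have hle := hc.length_le
  rcases mem_pieces.1 hd with rfl | ⟨m, hm, rfl⟩
  · left
    simp
    omega
  · right
    obtain ⟨j, hj, ho, h1, h2⟩ := ownerAt_spec k x (gap x c) (c.2.length + m + 1)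
    have hlen : (true :: (List.replicate m false ++ c.2)).length = c.2.length + m + 1 := by
      simp
      omega
    refine ⟨j, ?_, hj, ho, by rw [hlen]; omega, by simpa only [hlen] using h1,
      by simpa only [hlen] using h2⟩
    rcases Nat.eq_zero_or_pos j with rfl | h
    · have := h2 hc.gap_pos
      omega
    · exact h

theorem owner_suffix_of_mem_pieces (hc : Eligible k x c) (hd : d ∈ pieces k x c) :
    c.1 <:+ d.1 ∧ d.1 <:+ x := by
  rw [← hc.2.1]
  rcases owner_of_mem_pieces hc hd with ⟨h, -⟩ | ⟨j, -, hj, h, -⟩ <;> rw [h]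
  · exact ⟨List.drop_suffix _ _, List.suffix_rfl⟩
  · exact ⟨List.drop_suffix_drop_left _ hj, List.drop_suffix _ _⟩

theorem eq_of_mem_pieces_of_length_eq (hc : Eligible k x c) (hd : d ∈ pieces k x c)
    (he : e ∈ pieces k x c) (ho : d.1 = e.1) (hl : d.2.length = e.2.length) : d = e := by
  have hlen := hc.length_le
  have key : ∀ m, x ≠ ownerAt k x (gap x c) (c.2.length + m + 1) ∨ ¬ m < k 0 - c.2.length := by
    intro m
    by_contra! h
    obtain ⟨j, hj, ho, h1, h2⟩ := ownerAt_spec k x (gap x c) (c.2.length + m + 1)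
    have hj0 : j = 0 := by
      have h3 := congrArg List.length (h.1.trans ho)
      have := hc.1
      simp only [List.length_drop] at h3
      omega
    subst hj0
    have := h2 hc.gap_pos
    omega
  rcases mem_pieces.1 hd with rfl | ⟨i, hi, rfl⟩ <;> rcases mem_pieces.1 he with rfl | ⟨j, hj, rfl⟩
  · rfl
  · exact ((key j).elim (fun h => h ho) fun h => h hj).elim
  · exact ((key i).elim (fun h => h ho.symm) fun h => h hi).elim
  · have : i = j := by simpa using hl
    rw [this]

theorem nodup_pieces : (pieces k x c).Nodup := by
  refine List.nodup_cons.2 ⟨?_, List.Nodup.map_on ?_ List.nodup_range⟩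
  · simp only [List.mem_map, not_exists, not_and]
    intro j _ h
    have := congrArg (fun q => q.2) h
    exact not_true_cons_suffix_replicate ⟨[], this⟩
  · intro i _ j _ h
    have := congrArg (fun q => q.2) h
    exact true_cons_suffix_true_cons ⟨[], this⟩

noncomputable def weight (c : Cell) : ℝ := (1 / 2) ^ c.2.length

theorem sum_weight_pieces : ((pieces k x c).map weight).sum = weight c := by
  have key : ∀ m a : ℕ, (1 / 2 : ℝ) ^ (m + a) +
      ((List.range m).map fun j => (1 / 2 : ℝ) ^ (j + a + 1)).sum = (1 / 2) ^ a := by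
    intro m a
    induction m with
    | zero => simp
    | succ m ih =>
      rw [List.range_succ, List.map_append, List.sum_append, ← ih]
      simp
      ring
  rw [weight, ← key (k 0 - c.2.length) c.2.length]
  simp [pieces, weight, Function.comp_def]

end Pieces

/-! ### Choosing the cell to cut -/

section Best

variable {k : ℕ → ℕ} {x : List Bool} {c d e : Cell} {L : List Cell}

theorem cellKey_lt (hc : c.1.length < x.length) (h : c.2.length < d.2.length) :
    cellKey x c < cellKey x d := by
  unfold cellKey
  nlinarith

theorem exists_best (h : ∃ c ∈ L, Eligible k x c) : ∃ c ∈ L, Best k x L c := by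
  classical
  obtain ⟨c, hc, hmax⟩ := Finset.exists_max_image (L.toFinset.filter (Eligible k x)) (cellKey x)
    (by obtain ⟨c, hc, h⟩ := h; exact ⟨c, by simp [hc, h]⟩)
  simp only [Finset.mem_filter, List.mem_toFinset] at hc hmax
  refine ⟨c, hc.1, hc.2, fun d hd => ?_⟩
  by_cases h : Eligible k x d
  · exact Or.inr (hmax d ⟨hd, h⟩)
  · exact Or.inl h

theorem Best.key_le (hc : Best k x L c) (hd : d ∈ L) (h : Eligible k x d) :
    cellKey x d ≤ cellKey x c := (hc.2 d hd).resolve_left (not_not.2 h)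

theorem Best.length_le (hc : Best k x L c) (hd : d ∈ L) (h : Eligible k x d) :
    d.2.length ≤ c.2.length := by
  by_contra! hlt
  exact absurd (hc.key_le hd h) (not_le.2 (cellKey_lt hc.1.1 hlt))

theorem mem_allocate : d ∈ allocate k x L ↔
    ∃ c ∈ L, (Best k x L c ∧ d ∈ pieces k x c) ∨ (¬ Best k x L c ∧ d = c) := by
  classical
  simp only [allocate, List.mem_flatMap]
  refine exists_congr fun c => and_congr_right fun _ => ?_
  by_cases h : Best k x L c <;> simp [h]

theorem allocate_eq_self (h : ∀ c ∈ L, ¬ Eligible k x c) : allocate k x L = L := by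
  classical
  unfold allocate
  have : ∀ c ∈ L, (if Best k x L c then pieces k x c else [c]) = [c] := fun c hc =>
    if_neg fun hb => h c hc hb.1
  rw [List.flatMap_congr this]
  simp

theorem suffix_of_mem_allocate (h : d ∈ allocate k x L) :
    ∃ c ∈ L, c.1 <:+ d.1 ∧ c.2 <:+ d.2 := by
  obtain ⟨c, hc, ⟨hb, hd⟩ | ⟨-, rfl⟩⟩ := mem_allocate.1 h
  · exact ⟨c, hc, (owner_suffix_of_mem_pieces hb.1 hd).1, address_suffix_of_mem_pieces hd⟩
  · exact ⟨d, hc, List.suffix_rfl, List.suffix_rfl⟩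

end Best

/-! ### Invariants of the allocation -/

/-- The invariants of the allocation after the strings with codes less than `n` were processed. -/
structure CellInvariant (κ : List Bool → ℕ) (n : ℕ) (L : List Cell) : Prop where
  owner_lt : ∀ c ∈ L, c.1 = [] ∨ encode c.1 < n
  prefixFree : ∀ c ∈ L, ∀ d ∈ L, c.2 <:+ d.2 → c = d
  length_inj : ∀ c ∈ L, ∀ d ∈ L, c.1 = d.1 → c.2.length = d.2.length → c = d
  le_length : ∀ c ∈ L, c.1 ≠ [] → κ c.1 ≤ c.2.length
  unique : ∀ c ∈ L, ∀ d ∈ L, c.1 ≠ [] → d.1 = c.1 → c.2.length = κ c.1 → d = c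
  nodup : L.Nodup
  mass : (L.map weight).sum = 1

namespace CellInvariant

variable {κ : List Bool → ℕ} {n : ℕ} {x : List Bool} {L : List Cell} {c d : Cell}

theorem mono {m : ℕ} (h : CellInvariant κ n L) (hm : n ≤ m) : CellInvariant κ m L :=
  { h with owner_lt := fun c hc => (h.owner_lt c hc).imp_right fun h => h.trans_le hm }

theorem best_unique {k : ℕ → ℕ} (h : CellInvariant κ n L) (hc : c ∈ L) (hd : d ∈ L)
    (bc : Best k x L c) (bd : Best k x L d) : c = d := by
  have h1 := bc.length_le hd bd.1
  have h2 := bd.length_le hc bc.1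
  have h3 : c.2.length = d.2.length := le_antisymm h2 h1
  have h4 : c.1.length = d.1.length := by
    have h5 := bc.key_le hd bd.1
    have h6 := bd.key_le hc bc.1
    unfold cellKey at h5 h6
    rw [h3] at h5 h6
    omega
  refine h.length_inj c hc d hd ?_ h3
  rw [← bc.1.2.1, ← bd.1.2.1]
  unfold gap
  rw [h4]

theorem owner_ne (h : CellInvariant κ n L) (hx : x ≠ []) (hn : encode x = n) (hc : c ∈ L) :
    c.1 ≠ x := by
  rintro rfl
  rcases h.owner_lt c hc with h | h
  · exact hx h
  · omega

/-- An old cell with the owner of a new piece of length `l` that is not longer than `l` is itself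
eligible, hence not better than the cell that was cut. -/
theorem eligible_of_owner_eq {k : ℕ → ℕ} {j : ℕ} (hj : 0 < j) (hjx : j ≤ x.length)
    (ho : c.1 = x.drop j) (hle : ∀ j' < j, c.2.length ≤ k j') : Eligible k x c := by
  have hg : gap x c = j := by
    unfold gap
    rw [ho, List.length_drop]
    omega
  refine ⟨?_, ?_, ?_⟩
  · rw [ho, List.length_drop]
    omega
  · rw [hg, ho]
  · rw [hg]
    exact hle

theorem allocate (h : CellInvariant κ n L) (hx : x ≠ []) (hn : encode x = n) :
    CellInvariant κ (n + 1) (allocate (fun j => κ (x.drop j)) x L) := by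
  set k : ℕ → ℕ := fun j => κ (x.drop j) with hk
  have hk0 : k 0 = κ x := by simp [hk]
  -- A piece left to a nonempty proper ancestor is strictly longer than the complexity of that
  -- ancestor: either by the choice of `ownerAt`, or because it is a proper part of `c`, which
  -- already satisfied `le_length`.
  have strict : ∀ c ∈ L, Best k x L c → ∀ d ∈ pieces k x c, d.1 ≠ x → d.1 ≠ [] →
      κ d.1 < d.2.length := by
    intro c hc bc d hd hdx hd0
    rcases owner_of_mem_pieces bc.1 hd with ⟨ho, -⟩ | ⟨j, hj0, hj, ho, hlt, h1, h2⟩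
    · exact absurd ho hdx
    · rcases hj.lt_or_eq with hlt' | rfl
      · rw [ho]
        exact h2 hlt'
      · rw [bc.1.2.1] at ho
        rw [ho] at hd0 ⊢
        exact (h.le_length c hc hd0).trans_lt hlt
  -- Here the choice of `c` matters: an old cell `d` that clashes with a new piece of the same owner
  -- would itself be eligible and at least as good as `c`.
  have old : ∀ d ∈ L, ¬ Best k x L d → ∀ c ∈ L, Best k x L c → ∀ e ∈ pieces k x c,
      e.1 = d.1 → e.2.length ≠ d.2.length ∧ (d.1 ≠ [] → d.2.length ≠ κ d.1) := by
    intro d hd nd c hc bc e he heq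
    rcases owner_of_mem_pieces bc.1 he with ⟨ho, -⟩ | ⟨j, hj0, hj, ho, hlt, h1, h2⟩
    · exact absurd (heq.symm.trans ho) (h.owner_ne hx hn hd)
    · have hdo : d.1 = x.drop j := heq.symm.trans ho
      have hjx : j ≤ x.length := hj.trans gap_le
      constructor
      · intro hl
        have := bc.length_le hd (eligible_of_owner_eq hj0 hjx hdo (hl ▸ h1))
        omega
      · intro hne hl
        rcases hj.lt_or_eq with hlt' | rfl
        · have hkj : d.2.length = k j := by rw [hl, hdo]
          have h3 := h2 hlt'
          have h4 : Eligible k x d := eligible_of_owner_eq hj0 hjx hdo fun j' hj' => by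
            have := h1 j' hj'
            omega
          have h5 := bc.length_le hd h4
          have h6 := bc.1.2.2 j hlt'
          have h7 := bc.key_le hd h4
          have h8 : d.2.length = c.2.length := by omega
          have h9 := bc.1.length_owner
          have h10 : d.1.length = x.length - j := by rw [hdo, List.length_drop]
          -- The lengths tie, but the owner of `d` is strictly longer than that of `c`, so the
          -- tie-break contradicts the choice of `c`.
          unfold cellKey at h7
          rw [h8] at h7
          omega
        · rw [bc.1.2.1] at hdo
          exact nd (h.unique d hd c hc hne hdo.symm hl ▸ bc)
  refine ⟨?_, ?_, ?_, ?_, ?_, ?_, ?_⟩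
  · intro d hd
    obtain ⟨c, hc, ⟨bc, hd⟩ | ⟨-, rfl⟩⟩ := mem_allocate.1 hd
    · right
      have := encode_le_of_suffix (owner_suffix_of_mem_pieces bc.1 hd).2
      omega
    · exact (h.owner_lt d hc).imp_right fun h => h.trans (Nat.lt_succ_self n)
  · intro d hd e he hde
    obtain ⟨c, hc, hd⟩ := mem_allocate.1 hd
    obtain ⟨c', hc', he⟩ := mem_allocate.1 he
    have hcd : c.2 <:+ d.2 := by
      rcases hd with ⟨-, hd⟩ | ⟨-, rfl⟩
      exacts [address_suffix_of_mem_pieces hd, List.suffix_rfl]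
    have hce : c'.2 <:+ e.2 := by
      rcases he with ⟨-, he⟩ | ⟨-, rfl⟩
      exacts [address_suffix_of_mem_pieces he, List.suffix_rfl]
    have : c = c' := by
      rcases suffix_or_suffix (hcd.trans hde) hce with h' | h'
      · exact h.prefixFree c hc c' hc' h'
      · exact (h.prefixFree c' hc' c hc h').symm
    subst this
    rcases hd with ⟨b, hd⟩ | ⟨b, rfl⟩ <;> rcases he with ⟨b', he⟩ | ⟨b', rfl⟩
    · exact eq_of_mem_pieces_of_suffix hd he hde
    · exact absurd b b'
    · exact absurd b' b
    · rfl
  · intro d hd e he ho hl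
    obtain ⟨c, hc, ⟨b, hd⟩ | ⟨b, rfl⟩⟩ := mem_allocate.1 hd <;>
      obtain ⟨c', hc', ⟨b', he⟩ | ⟨b', rfl⟩⟩ := mem_allocate.1 he
    · obtain rfl := h.best_unique hc hc' b b'
      exact eq_of_mem_pieces_of_length_eq b.1 hd he ho hl
    · exact absurd hl (old e hc' b' c hc b d hd ho).1
    · exact absurd hl.symm (old d hc b c' hc' b' e he ho.symm).1
    · exact h.length_inj d hc e hc' ho hl
  · intro d hd hne
    obtain ⟨c, hc, ⟨b, hd⟩ | ⟨b, rfl⟩⟩ := mem_allocate.1 hd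
    · by_cases hdx : d.1 = x
      · rcases owner_of_mem_pieces b.1 hd with ⟨-, hl⟩ | ⟨j, hj0, hj, ho, -⟩
        · rw [hdx, hl, hk0]
        · have h1 := congrArg List.length (hdx.symm.trans ho)
          have h2 := b.1.1
          rw [List.length_drop] at h1
          omega
      · exact (strict c hc b d hd hdx hne).le
    · exact h.le_length d hc hne
  · intro d hd e he hne ho hl
    obtain ⟨c, hc, ⟨b, hd⟩ | ⟨b, rfl⟩⟩ := mem_allocate.1 hd <;>
      obtain ⟨c', hc', ⟨b', he⟩ | ⟨b', rfl⟩⟩ := mem_allocate.1 he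
    · obtain rfl := h.best_unique hc hc' b b'
      by_cases hdx : d.1 = x
      · have aux : ∀ f ∈ pieces k x c, f.1 = x → f.2.length = k 0 := by
          intro f hf hfx
          rcases owner_of_mem_pieces b.1 hf with ⟨-, hl⟩ | ⟨j, hj0, hj, ho, -⟩
          · exact hl
          · have h1 := congrArg List.length (hfx.symm.trans ho)
            have h2 := b.1.1
            rw [List.length_drop] at h1
            omega
        exact eq_of_mem_pieces_of_length_eq b.1 he hd ho
          ((aux e he (ho.trans hdx)).trans (aux d hd hdx).symm)
      · exact absurd hl (strict c hc b d hd hdx hne).ne'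
    · by_cases hdx : d.1 = x
      · exact absurd (ho.trans hdx) (h.owner_ne hx hn hc')
      · exact absurd hl (strict c hc b d hd hdx hne).ne'
    · exact absurd hl ((old d hc b c' hc' b' e he ho).2 hne)
    · exact h.unique d hc e hc' hne ho hl
  · classical
    refine List.nodup_flatMap.2 ⟨fun c _ => ?_, h.nodup.imp_of_mem fun {c c'} hc hc' hne => ?_⟩
    · split_ifs
      · exact nodup_pieces
      · exact List.nodup_singleton c
    · intro e he he'
      have aux : ∀ c : Cell, e ∈ (if Best k x L c then pieces k x c else [c]) → c.2 <:+ e.2 := by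
        intro c he
        split_ifs at he
        · exact address_suffix_of_mem_pieces he
        · rw [List.mem_singleton.1 he]
      rcases suffix_or_suffix (aux c he) (aux c' he') with h' | h'
      · exact hne (h.prefixFree c hc c' hc' h')
      · exact hne (h.prefixFree c' hc' c hc h').symm
  · rw [← h.mass, _root_.allocate, List.map_flatMap, List.flatMap_def, List.sum_flatten, List.map_map]
    congr 1
    refine List.map_congr_left fun c _ => ?_
    simp only [Function.comp]
    split_ifs with b
    · exact sum_weight_pieces
    · simp

end CellInvariant

/-! ### Mass estimates -/

section Mass

theorem sum_half_pow_lt (A : Finset ℕ) (K : ℕ) (hA : ∀ l ∈ A, K < l) :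
    ∑ l ∈ A, (1 / 2 : ℝ) ^ l < (1 / 2) ^ K := by
  have key : ∀ m : ℕ, ∑ l ∈ Finset.range m, (1 / 2 : ℝ) ^ (K + 1 + l) =
      (1 / 2) ^ K - (1 / 2) ^ (K + m) := by
    intro m
    induction m with
    | zero => simp
    | succ m ih =>
      rw [Finset.sum_range_succ, ih]
      ring
  have hsub : A ⊆ (Finset.range (A.sup id)).image fun l => K + 1 + l := by
    intro l hl
    have h1 := hA l hl
    have h2 : l ≤ A.sup id := Finset.le_sup (f := id) hl
    exact Finset.mem_image.2 ⟨l - (K + 1), Finset.mem_range.2 (by omega), by omega⟩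
  refine (Finset.sum_le_sum_of_subset_of_nonneg hsub fun _ _ _ => by positivity).trans_lt ?_
  rw [Finset.sum_image fun a _ b _ h => by simpa using h, key]
  have : (0 : ℝ) < (1 / 2) ^ (K + A.sup id) := by positivity
  linarith

theorem sum_weight_lt (S : Finset Cell) (K : ℕ)
    (hinj : ∀ c ∈ S, ∀ d ∈ S, c.2.length = d.2.length → c = d)
    (hS : ∀ c ∈ S, K < c.2.length) : ∑ c ∈ S, weight c < (1 / 2) ^ K := by
  have := sum_half_pow_lt (S.image fun c => c.2.length) K
    (Finset.forall_mem_image.2 hS)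
  rwa [Finset.sum_image fun c hc d hd h => hinj c hc d hd h] at this

/-- Replace the last `M` by a slightly smaller claim on some earlier `G i`. If `i` is the last
index, use it up and continue with the preceding `M`; otherwise that preceding `M` is paid by its
own `G`, and the claim moves one place back. The strict inequality survives to the end. -/
theorem sum_range_lt_of_chain {M G : ℕ → ℝ} {N : ℕ} (hM : ∀ j, 0 < j → j < N → M j ≤ G j)
    (hlt : ∀ j, 0 < j → j ≤ N → ∃ i < j, M j < G i) (hN : 0 < N) :
    ∑ j ∈ Finset.range N, M (j + 1) < ∑ j ∈ Finset.range N, G j := by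
  have key : ∀ i < N, ∀ a, (∃ j ≤ i, a < G j) →
      ∑ j ∈ Finset.range i, M (j + 1) + a < ∑ j ∈ Finset.range (i + 1), G j := by
    intro i
    induction i with
    | zero =>
      rintro - a ⟨j, hj, ha⟩
      obtain rfl : j = 0 := by omega
      simpa using ha
    | succ i ih =>
      rintro hi a ⟨j, hj, ha⟩
      rw [Finset.sum_range_succ, Finset.sum_range_succ (n := i + 1)]
      rcases hj.lt_or_eq with hj | rfl
      · have h1 := ih (by omega) a ⟨j, by omega, ha⟩
        have h2 := hM (i + 1) (by omega) hi
        linarith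
      · obtain ⟨j', hj', h⟩ := hlt (i + 1) (by omega) hi.le
        have h1 := ih (by omega) (M (i + 1)) ⟨j', by omega, h⟩
        linarith
  obtain ⟨N, rfl⟩ : ∃ m, N = m + 1 := ⟨N - 1, by omega⟩
  obtain ⟨i, hi, h⟩ := hlt (N + 1) hN le_rfl
  rw [Finset.sum_range_succ (fun j => M (j + 1))]
  exact key N (by omega) (M (N + 1)) ⟨i, by omega, h⟩

end Mass

namespace CellInvariant

variable {κ : List Bool → ℕ} {n : ℕ} {x : List Bool} {L : List Cell}

/-- Either `z` has a single cell, of measure exactly `2^(-κ z)`, or its cells have distinct lengths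
above `κ z` and a finite part of a geometric series bounds them. -/
theorem sum_owner_le (h : CellInvariant κ n L) {z : List Bool} (hz : z ≠ []) :
    ∑ c ∈ L.toFinset with c.1 = z, weight c ≤ (1 / 2) ^ κ z := by
  by_cases hex : ∃ c ∈ L, c.1 = z ∧ c.2.length = κ z
  · obtain ⟨c, hc, rfl, hl⟩ := hex
    have : (L.toFinset.filter fun d => d.1 = c.1) = {c} := by
      ext d
      simp only [Finset.mem_filter, List.mem_toFinset, Finset.mem_singleton]
      constructor
      · rintro ⟨hd, ho⟩
        exact h.unique c hc d hd hz ho hl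
      · rintro rfl
        exact ⟨hc, rfl⟩
    rw [this, Finset.sum_singleton, weight, hl]
  · push Not at hex
    refine (sum_weight_lt _ _ ?_ ?_).le
    · simp only [Finset.mem_filter, List.mem_toFinset]
      rintro c ⟨hc, hcz⟩ d ⟨hd, hdz⟩ hl
      exact h.length_inj c hc d hd (hcz.trans hdz.symm) hl
    · simp only [Finset.mem_filter, List.mem_toFinset]
      rintro c ⟨hc, rfl⟩
      exact lt_of_le_of_ne (h.le_length c hc hz) (hex c hc rfl).symm

theorem exists_eligible (h : CellInvariant κ n L)
    (hsum : ∀ F : Finset (List Bool), ∑ y ∈ F, (1 / 2 : ℝ) ^ κ y ≤ 1)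
    (hx : x ≠ []) (hn : encode x = n) :
    ∃ c ∈ L, Eligible (fun j => κ (x.drop j)) x c := by
  classical
  by_contra! hno
  set m : List Bool → ℝ := fun z => ∑ c ∈ L.toFinset with c.1 = z, weight c with hm
  have hlen : 0 < x.length := List.length_pos_iff.2 hx
  have hchain : ∑ j ∈ Finset.range x.length, m (x.drop (j + 1)) <
      ∑ j ∈ Finset.range x.length, (1 / 2 : ℝ) ^ κ (x.drop j) := by
    refine sum_range_lt_of_chain (M := fun j => m (x.drop j))
      (G := fun j => (1 / 2 : ℝ) ^ κ (x.drop j)) ?_ ?_ hlen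
    · intro j _ hj
      exact h.sum_owner_le (by simpa using hj)
    · intro j hj0 hj
      -- A cell of `x.drop j` no longer than the least complexity below it on the path would be
      -- eligible; so all its cells are longer than that minimum.
      obtain ⟨i, hi, hmin⟩ := Finset.exists_min_image (Finset.range j) (fun i => κ (x.drop i))
        ⟨0, Finset.mem_range.2 hj0⟩
      refine ⟨i, Finset.mem_range.1 hi, sum_weight_lt _ _ ?_ ?_⟩
      · simp only [Finset.mem_filter, List.mem_toFinset]
        rintro c ⟨hc, hcz⟩ d ⟨hd, hdz⟩ hl
        exact h.length_inj c hc d hd (hcz.trans hdz.symm) hl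
      · simp only [Finset.mem_filter, List.mem_toFinset]
        rintro c ⟨hc, hcz⟩
        by_contra! hle
        refine hno c hc (eligible_of_owner_eq hj0 hj hcz fun j' hj' => ?_)
        exact hle.trans (hmin j' (Finset.mem_range.2 hj'))
  have hdrop : Set.InjOn (fun j => x.drop j) (Set.Iic x.length) := by
    intro i hi j hj hij
    have := congrArg List.length hij
    simp only [List.length_drop, Set.mem_Iic] at this hi hj
    omega
  -- `A` holds the proper ancestors of `x`, including `[]`, which has no mass bound of its own. `B`
  -- trades `[]` for `x`, which owns nothing yet, so its share of the sum is still free.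
  set A : Finset (List Bool) := (Finset.range x.length).image fun j => x.drop (j + 1) with hA
  set B : Finset (List Bool) := (Finset.range x.length).image fun j => x.drop j with hB
  set O : Finset (List Bool) := L.toFinset.image Prod.fst ∪ A with hO
  have hnil : [] ∈ A := Finset.mem_image.2 ⟨x.length - 1, Finset.mem_range.2 (by omega), by
    rw [List.drop_eq_nil_iff]; omega⟩
  have htotal : ∑ z ∈ O, m z = 1 := by
    rw [← h.mass, ← List.sum_toFinset _ h.nodup]
    refine Finset.sum_fiberwise_of_maps_to (fun c hc => ?_) _
    exact Finset.mem_union_left _ (Finset.mem_image_of_mem _ hc)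
  have hAB : ∑ z ∈ A, m z < ∑ z ∈ B, (1 / 2 : ℝ) ^ κ z := by
    rw [hA, hB, Finset.sum_image, Finset.sum_image]
    · exact hchain
    · intro i hi j hj hij
      simp only [Finset.coe_range, Set.mem_Iio] at hi hj
      exact hdrop (by simp; omega) (by simp; omega) hij
    · intro i hi j hj hij
      simp only [Finset.coe_range, Set.mem_Iio] at hi hj
      have := @hdrop (i + 1) (by simp; omega) (j + 1) (by simp; omega) hij
      omega
  have hrest : ∑ z ∈ O \ A, m z ≤ ∑ z ∈ O \ A, (1 / 2 : ℝ) ^ κ z := by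
    refine Finset.sum_le_sum fun z hz => h.sum_owner_le ?_
    rintro rfl
    exact (Finset.mem_sdiff.1 hz).2 hnil
  have hdisj : Disjoint (O \ A) B := by
    rw [Finset.disjoint_left]
    intro z hz hzB
    rw [Finset.mem_sdiff] at hz
    obtain ⟨j, hj, rfl⟩ := Finset.mem_image.1 hzB
    rw [Finset.mem_range] at hj
    rcases Nat.eq_zero_or_pos j with rfl | hj0
    · rcases Finset.mem_union.1 hz.1 with h' | h'
      · obtain ⟨c, hc, hcx⟩ := Finset.mem_image.1 h'
        exact h.owner_ne hx hn (List.mem_toFinset.1 hc) (by simpa using hcx)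
      · exact hz.2 h'
    · exact hz.2 (Finset.mem_image.2 ⟨j - 1, Finset.mem_range.2 (by omega), by
        rw [Nat.sub_add_cancel hj0]⟩)
  have hle := hsum ((O \ A) ∪ B)
  rw [Finset.sum_union hdisj] at hle
  have hsplit := Finset.sum_sdiff (f := m) (Finset.subset_union_right : A ⊆ O)
  rw [← hO] at hsplit
  linarith

end CellInvariant

/-! ### The invariants hold at every stage -/

theorem stage_encode (x : List Bool) : stage (encode x) = x := by
  simp [stage]

theorem encode_stage {n : ℕ} (h : stage n ≠ []) : encode (stage n) = n := by
  unfold stage at h ⊢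
  cases hd : decode₂ (List Bool) n with
  | none => simp [hd] at h
  | some x => exact mem_decode₂.1 hd

theorem cells_succ_of_stage_eq_nil {κ : List Bool → ℕ} {n : ℕ} (h : stage n = []) :
    cells κ (n + 1) = cells κ n := by
  rw [cells, h]
  refine allocate_eq_self fun c _ hc => ?_
  have := hc.1
  simp at this

theorem cellInvariant_cells {κ : List Bool → ℕ} (n : ℕ) : CellInvariant κ n (cells κ n) := by
  induction n with
  | zero => constructor <;> simp [cells, weight]
  | succ n ih =>
    by_cases h : stage n = []
    · rw [cells_succ_of_stage_eq_nil h]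
      exact ih.mono (Nat.le_succ n)
    · exact ih.allocate h (encode_stage h)

/-! ### Prefixes of infinite sequences -/

/-- The first `n` bits of `β`, the most recent one first. -/
def revPrefix (β : ℕ → Bool) : ℕ → List Bool
  | 0 => []
  | n + 1 => β n :: revPrefix β n

section RevPrefix

variable {β : ℕ → Bool} {p : List Bool}

theorem reverse_revPrefix (β : ℕ → Bool) (n : ℕ) : (revPrefix β n).reverse = bitPrefix β n := by
  induction n with
  | zero => rfl
  | succ n ih => simp [revPrefix, ih, bitPrefix, List.range_succ]

@[simp]
theorem length_revPrefix (β : ℕ → Bool) (n : ℕ) : (revPrefix β n).length = n := by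
  induction n with
  | zero => rfl
  | succ n ih => simp [revPrefix, ih]

theorem revPrefix_suffix (β : ℕ → Bool) {m n : ℕ} (h : m ≤ n) :
    revPrefix β m <:+ revPrefix β n := by
  induction n, h using Nat.le_induction with
  | base => exact List.suffix_rfl
  | succ n _ ih => exact ih.trans (List.suffix_cons _ _)

theorem eq_revPrefix_of_suffix {n : ℕ} (h : p <:+ revPrefix β n) :
    p = revPrefix β p.length := by
  have h1 : p.length ≤ n := by simpa using h.length_le
  rcases suffix_or_suffix h (revPrefix_suffix β h1) with h2 | h2
  · exact h2.eq_of_length (by simp)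
  · exact (h2.eq_of_length (by simp)).symm

theorem exists_revPrefix_eq (p : List Bool) : ∃ β : ℕ → Bool, revPrefix β p.length = p := by
  refine ⟨fun i => p.reverse.getD i false, ?_⟩
  rw [← List.reverse_inj, reverse_revPrefix]
  refine List.ext_getElem (by simp [bitPrefix]) fun i h1 h2 => ?_
  simp only [bitPrefix, List.getElem_map, List.getElem_range]
  rw [List.getD_eq_getElem _ _ h2]

theorem revPrefix_cases {a : ℕ} (h : revPrefix β a = p) (m : ℕ) :
    revPrefix β (a + m) = List.replicate m false ++ p ∨
      ∃ j < m, revPrefix β (a + j + 1) = true :: (List.replicate j false ++ p) := by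
  induction m with
  | zero => simp [h]
  | succ m ih =>
    rcases ih with ih | ⟨j, hj, ih⟩
    · cases hb : β (a + m)
      · left
        rw [← Nat.add_assoc, revPrefix, hb, ih]
        simp [List.replicate_succ]
      · right
        exact ⟨m, Nat.lt_succ_self m, by rw [revPrefix, hb, ih]⟩
    · exact Or.inr ⟨j, hj.trans (Nat.lt_succ_self m), ih⟩

theorem isLocallyConstant_revPrefix (n : ℕ) :
    IsLocallyConstant fun β : ℕ → Bool => revPrefix β n := by
  induction n with
  | zero => exact IsLocallyConstant.const []
  | succ n ih =>
    have : IsLocallyConstant fun β : ℕ → Bool => β n :=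
      (IsLocallyConstant.iff_continuous _).2 (continuous_apply n)
    exact this.comp₂ ih List.cons

end RevPrefix

/-! ### Blocks and the existence of the oracle -/

def Compatible (p q : List Bool) : Prop := p <:+ q ∨ q <:+ p

/-- At step `n` the whole subtree below the address `p` is handed over to the string `z`: before
it lies in a single cell not belonging to `z`, afterwards it belongs to `z`. -/
def Block (κ : List Bool → ℕ) (z p : List Bool) (n : ℕ) : Prop :=
  (∃ c ∈ cells κ n, c.2 <:+ p ∧ ¬ z <:+ c.1) ∧
    ∀ d ∈ cells κ (n + 1), Compatible d.2 p → z <:+ d.1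

section Cells

variable {κ : List Bool → ℕ}

theorem exists_cell_of_le {m n : ℕ} (h : m ≤ n) {d : Cell} (hd : d ∈ cells κ n) :
    ∃ c ∈ cells κ m, c.1 <:+ d.1 ∧ c.2 <:+ d.2 := by
  induction n, h using Nat.le_induction generalizing d with
  | base => exact ⟨d, hd, List.suffix_rfl, List.suffix_rfl⟩
  | succ n _ ih =>
    obtain ⟨e, he, h1, h2⟩ := suffix_of_mem_allocate hd
    obtain ⟨c, hc, h3, h4⟩ := ih he
    exact ⟨c, hc, h3.trans h1, h4.trans h2⟩

/-- The cells cover the oracle space: below a cut cell, `β` either follows the zeros to the end or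
leaves them at its first `true`, and each case is one of the pieces. -/
theorem exists_cell_revPrefix (β : ℕ → Bool) (n : ℕ) :
    ∃ c ∈ cells κ n, revPrefix β c.2.length = c.2 := by
  induction n with
  | zero => exact ⟨([], []), by simp [cells], rfl⟩
  | succ n ih =>
    obtain ⟨c, hc, hβ⟩ := ih
    by_cases hb : Best (fun j => κ ((stage n).drop j)) (stage n) (cells κ n) c
    · rcases revPrefix_cases hβ (κ (stage n) - c.2.length) with h | ⟨j, hj, h⟩
      · refine ⟨_, mem_allocate.2 ⟨c, hc, Or.inl ⟨hb, mem_pieces.2 (Or.inl rfl)⟩⟩, ?_⟩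
        simpa [Nat.add_comm] using h
      · refine ⟨_, mem_allocate.2 ⟨c, hc, Or.inl ⟨hb, mem_pieces.2 (Or.inr ⟨j, by simpa using hj,
          rfl⟩)⟩⟩, ?_⟩
        rw [← h]
        simp
    · exact ⟨c, mem_allocate.2 ⟨c, hc, Or.inr ⟨hb, rfl⟩⟩, hβ⟩

/-- Trace `d` back to the step at which its ancestor cell passed to an extension of `z`. -/
theorem exists_block {n : ℕ} {d : Cell} (hd : d ∈ cells κ n) {z : List Bool} (hz : z ≠ [])
    (hzd : z <:+ d.1) : ∃ p m, p <:+ d.2 ∧ p.length ≤ κ z ∧ Block κ z p m := by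
  induction n generalizing d with
  | zero =>
    have : d = ([], []) := by simpa [cells] using hd
    subst this
    exact absurd (List.suffix_nil.1 hzd) hz
  | succ n ih =>
    obtain ⟨c, hc, ⟨b, hdc⟩ | ⟨-, rfl⟩⟩ := mem_allocate.1 hd
    swap
    · exact ih hc hzd
    by_cases hzc : z <:+ c.1
    · obtain ⟨p, m, hp, hl, hB⟩ := ih hc hzc
      exact ⟨p, m, hp.trans (address_suffix_of_mem_pieces hdc), hl, hB⟩
    set x := stage n with hx
    set k : ℕ → ℕ := fun j => κ (x.drop j) with hk
    have hzx : z <:+ x := hzd.trans (owner_suffix_of_mem_pieces b.1 hdc).2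
    have hzlen := hzx.length_le
    obtain ⟨i, hi⟩ : ∃ i, i = x.length - z.length := ⟨_, rfl⟩
    have hzi : z = x.drop i := by
      rw [hi]
      exact List.suffix_iff_eq_drop.1 hzx
    have suffix_z : ∀ j, z <:+ x.drop j ↔ j ≤ i := by
      intro j
      constructor
      · intro h
        have h1 := h.length_le
        have h2 : 0 < z.length := List.length_pos_iff.2 hz
        rw [List.length_drop] at h1
        omega
      · intro h
        rw [hzi]
        exact List.drop_suffix_drop_left _ h
    have hig : i < gap x c := by
      by_contra! h
      exact hzc (by rw [← b.1.2.1]; exact (suffix_z _).2 h)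
    -- A side piece goes to an extension of `z` exactly when its length exceeds the least complexity
    -- between `x` and `z`. That minimum, `k i₁`, is therefore the length of the block.
    obtain ⟨i₁, hi₁, hmin⟩ := Finset.exists_min_image (Finset.range (i + 1)) k ⟨0, by simp⟩
    simp only [Finset.mem_range] at hi₁ hmin
    have ha : c.2.length ≤ k i₁ := b.1.2.2 i₁ (by omega)
    refine ⟨List.replicate (k i₁ - c.2.length) false ++ c.2, n, ?_, ?_,
      ⟨c, hc, List.suffix_append _ _, hzc⟩, ?_⟩
    · rcases mem_pieces.1 hdc with rfl | ⟨m, hm, rfl⟩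
      · rw [suffix_append_right_iff]
        have := hmin 0 (by omega)
        exact ⟨List.replicate (k 0 - k i₁) false, by
          rw [List.replicate_append_replicate]; congr 1; omega⟩
      · rw [replicate_append_suffix_iff]
        obtain ⟨j, hj, ho, h1, h2⟩ := ownerAt_spec k x (gap x c) (c.2.length + m + 1)
        have hji : j ≤ i := (suffix_z j).1 (ho ▸ hzd)
        have h3 := h2 (by omega)
        have h4 := hmin j (by omega)
        omega
    · have := hmin i (by omega)
      have h' : κ z = k i := by rw [hk, hzi]
      simp
      omega
    · intro e he hcomp
      obtain ⟨c', hc', he⟩ := mem_allocate.1 he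
      have hce : c'.2 <:+ e.2 := by
        rcases he with ⟨-, he⟩ | ⟨-, rfl⟩
        exacts [address_suffix_of_mem_pieces he, List.suffix_rfl]
      have hcc : c'.2 <:+ c.2 ∨ c.2 <:+ c'.2 := by
        rcases hcomp with h | h
        · exact suffix_or_suffix (hce.trans h) (List.suffix_append _ _)
        · exact suffix_or_suffix hce ((List.suffix_append _ _).trans h)
      have hI := cellInvariant_cells (κ := κ) n
      obtain rfl : c = c' := by
        rcases hcc with h | h
        · exact (hI.prefixFree _ hc' _ hc h).symm
        · exact hI.prefixFree _ hc _ hc' h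
      have hep : e ∈ pieces k x c := by
        rcases he with ⟨-, he⟩ | ⟨nb, -⟩
        exacts [he, absurd b nb]
      rcases mem_pieces.1 hep with rfl | ⟨m, hm, rfl⟩
      · exact hzx
      · have hm' : k i₁ - c.2.length ≤ m := by
          rcases hcomp with h | h
          · exact absurd h not_true_cons_suffix_replicate
          · exact replicate_append_suffix_iff.1 h
        obtain ⟨j, hj, ho, h1, h2⟩ := ownerAt_spec k x (gap x c) (c.2.length + m + 1)
        change z <:+ ownerAt k x (gap x c) (c.2.length + m + 1)
        rw [ho, suffix_z]
        by_contra! hij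
        have := h1 i₁ (by omega)
        omega

theorem exists_cell_owner (hsum : ∀ F : Finset (List Bool), ∑ y ∈ F, (1 / 2 : ℝ) ^ κ y ≤ 1)
    (x : List Bool) : ∃ n, ∃ c ∈ cells κ n, c.1 = x := by
  by_cases hx : x = []
  · exact ⟨0, ([], []), by simp [cells], hx.symm⟩
  · obtain ⟨c, hc, b⟩ := exists_best
      ((cellInvariant_cells (encode x)).exists_eligible hsum hx rfl)
    refine ⟨encode x + 1, _, mem_allocate.2 ⟨c, hc, Or.inl ⟨?_, mem_pieces.2 (Or.inl rfl)⟩⟩, ?_⟩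
    · rwa [stage_encode]
    · exact stage_encode x

/-- The condition for each `n` depends on boundedly many bits of `β`, so it is closed. A cell owned
by the prefix of length `N` satisfies the conditions up to `N`, and compactness of Cantor space
gives all of them at once. -/
theorem exists_oracle (hsum : ∀ F : Finset (List Bool), ∑ y ∈ F, (1 / 2 : ℝ) ^ κ y ≤ 1)
    (α : ℕ → Bool) : ∃ β : ℕ → Bool, ∀ n, 0 < n →
      ∃ k ≤ κ (revPrefix α n), ∃ m, Block κ (revPrefix α n) (revPrefix β k) m := by
  set P : ℕ → (ℕ → Bool) → Prop := fun n β =>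
    ∃ k ≤ κ (revPrefix α n), ∃ m, Block κ (revPrefix α n) (revPrefix β k) m with hP
  have hclosed : ∀ n, IsClosed {β | P n β} := by
    intro n
    have : {β | P n β} = ⋃ k ∈ Set.Iic (κ (revPrefix α n)),
        {β | ∃ m, Block κ (revPrefix α n) (revPrefix β k) m} := by
      ext β
      simp [hP]
    rw [this]
    refine (Set.finite_Iic _).isClosed_biUnion fun k _ => ?_
    rw [← isOpen_compl_iff]
    exact isLocallyConstant_revPrefix k {p | ∃ m, Block κ (revPrefix α n) p m}ᶜ
  have hne : (⋂ N : ℕ, ⋂ n ∈ Set.Ioc 0 N, {β | P n β}).Nonempty := by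
    refine IsCompact.nonempty_iInter_of_sequence_nonempty_isCompact_isClosed _ ?_ ?_ ?_ ?_
    · intro N
      exact Set.biInter_subset_biInter_left (Set.Ioc_subset_Ioc_right (Nat.le_succ N))
    · intro N
      obtain ⟨s, c, hc, ho⟩ := exists_cell_owner hsum (revPrefix α N)
      obtain ⟨β, hβ⟩ := exists_revPrefix_eq c.2
      refine ⟨β, Set.mem_iInter₂.2 fun n hn => ?_⟩
      obtain ⟨p, m, hp, hl, hB⟩ := exists_block hc (z := revPrefix α n)
        (by rw [← List.length_pos_iff]; simpa using hn.1)
        (by rw [ho]; exact revPrefix_suffix α hn.2)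
      rw [← hβ] at hp
      exact ⟨p.length, hl, m, by rwa [← eq_revPrefix_of_suffix hp]⟩
    · exact (isClosed_biInter fun n _ => hclosed n).isCompact
    · exact fun N => isClosed_biInter fun n _ => hclosed n
  obtain ⟨β, hβ⟩ := hne
  refine ⟨β, fun n hn => ?_⟩
  exact Set.mem_iInter₂.1 (Set.mem_iInter.1 hβ n) n ⟨hn, le_rfl⟩

end Cells

/-! ### The decoder -/

/-- The internal memory of the decoder: the bits written, the bits read (both with the most recent
bit first) and the stage of the allocation. -/
abbrev DecoderState := List Bool × List Bool × ℕ

/-- All cells of `L` that are compatible with the bits read belong to `z`. -/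
def Determined (L : List Cell) (q z : List Bool) : Prop :=
  ∀ d ∈ L, ¬ Compatible d.2 q ∨ z <:+ d.1

def Undecided (L : List Cell) (q z : List Bool) : Prop :=
  ∃ d ∈ L, Compatible d.2 q ∧ z <:+ d.1 ∧ ¬ d.1 = z

open Classical in
-- Reading is the last resort before the next stage and needs a compatible cell of a proper
-- extension of the output: if there is none, a further bit might be wasted.
noncomputable def action (L : List Cell) (s : DecoderState) : ℕ ⊕ ((ℕ × ℕ) ⊕ (Bool × ℕ)) :=
  if Determined L s.2.1 (true :: s.1) then Sum.inr (Sum.inr (true, encode (true :: s.1, s.2)))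
  else if Determined L s.2.1 (false :: s.1) then
    Sum.inr (Sum.inr (false, encode (false :: s.1, s.2)))
  else if Undecided L s.2.1 s.1 then
    Sum.inr (Sum.inl (encode (s.1, false :: s.2.1, s.2.2), encode (s.1, true :: s.2.1, s.2.2)))
  else Sum.inl (encode (s.1, s.2.1, s.2.2 + 1))

section Computability

variable {α : Type*} [Primcodable α] {L : α → List Cell} {q z : α → List Bool}

theorem primrecPred_compatible {p : α → List Bool} (hp : Primrec p) (hq : Primrec q) :
    PrimrecPred fun a => Compatible (p a) (q a) :=
  (PrimrecPred.suffix_of hp hq).or (PrimrecPred.suffix_of hq hp)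

theorem primrecPred_determined (hL : Primrec L) (hq : Primrec q) (hz : Primrec z) :
    PrimrecPred fun a => Determined (L a) (q a) (z a) :=
  PrimrecPred.forall_mem_of hL ((primrecPred_compatible (Primrec.snd.comp Primrec.snd)
    (hq.comp Primrec.fst)).not.or
      (PrimrecPred.suffix_of (hz.comp Primrec.fst) (Primrec.fst.comp Primrec.snd)))

theorem primrecPred_undecided (hL : Primrec L) (hq : Primrec q) (hz : Primrec z) :
    PrimrecPred fun a => Undecided (L a) (q a) (z a) :=
  PrimrecPred.exists_mem_of hL ((primrecPred_compatible (Primrec.snd.comp Primrec.snd)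
    (hq.comp Primrec.fst)).and
      ((PrimrecPred.suffix_of (hz.comp Primrec.fst) (Primrec.fst.comp Primrec.snd)).and
        (Primrec.eq.comp (Primrec.fst.comp Primrec.snd) (hz.comp Primrec.fst)).not))

theorem primrec_action : Primrec fun a : List Cell × DecoderState => action a.1 a.2 := by
  have hL : Primrec fun a : List Cell × DecoderState => a.1 := Primrec.fst
  have hz : Primrec fun a : List Cell × DecoderState => a.2.1 := Primrec.fst.comp Primrec.snd
  have hqt : Primrec fun a : List Cell × DecoderState => a.2.2 := Primrec.snd.comp Primrec.snd
  have hq : Primrec fun a : List Cell × DecoderState => a.2.2.1 := Primrec.fst.comp hqt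
  have ht : Primrec fun a : List Cell × DecoderState => a.2.2.2 := Primrec.snd.comp hqt
  have cons (b : Bool) {f : List Cell × DecoderState → List Bool} (hf : Primrec f) :
      Primrec fun a => b :: f a := Primrec.list_cons.comp (Primrec.const b) hf
  classical
  refine Primrec.ite (primrecPred_determined hL hq (cons true hz)) ?_
    (Primrec.ite (primrecPred_determined hL hq (cons false hz)) ?_
      (Primrec.ite (primrecPred_undecided hL hq hz) ?_ ?_))
  · exact Primrec.sumInr.comp (Primrec.sumInr.comp (Primrec.pair (Primrec.const true)
      (Primrec.encode.comp (Primrec.pair (cons true hz) hqt))))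
  · exact Primrec.sumInr.comp (Primrec.sumInr.comp (Primrec.pair (Primrec.const false)
      (Primrec.encode.comp (Primrec.pair (cons false hz) hqt))))
  · exact Primrec.sumInr.comp (Primrec.sumInl.comp (Primrec.pair
      (Primrec.encode.comp (Primrec.pair hz (Primrec.pair (cons false hq) ht)))
      (Primrec.encode.comp (Primrec.pair hz (Primrec.pair (cons true hq) ht)))))
  · exact Primrec.sumInl.comp
      (Primrec.encode.comp (Primrec.pair hz (Primrec.pair hq (Primrec.succ.comp ht))))

end Computability

def decodeState (m : ℕ) : DecoderState := (decode m).getD ([], [], 0)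

theorem primrec_decodeState : Primrec decodeState :=
  Primrec.option_getD.comp Primrec.decode (Primrec.const _)

noncomputable def decoder (κ : List Bool → ℕ) (hκ : Computable κ) : OracleMachine where
  start := encode (([], [], 0) : DecoderState)
  instr m := action (cells κ (decodeState m).2.2) (decodeState m)
  computable_instr := primrec_action.to_comp.comp (Computable.pair
    ((computable_cells hκ).comp
      (Primrec.snd.comp (Primrec.snd.comp primrec_decodeState)).to_comp)
    primrec_decodeState.to_comp)

/-! ### Correctness and oracle use of the decoder -/

section Compatible

variable {a b c : List Bool}

theorem Compatible.of_suffix_left (h : Compatible a b) (hc : c <:+ a) : Compatible c b :=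
  h.elim (fun h => Or.inl (hc.trans h)) fun h => suffix_or_suffix hc h

theorem Compatible.of_suffix_right (h : Compatible a b) (hc : c <:+ b) : Compatible a c :=
  h.elim (fun h => suffix_or_suffix h hc) fun h => Or.inr (hc.trans h)

theorem compatible_revPrefix (β : ℕ → Bool) (m n : ℕ) :
    Compatible (revPrefix β m) (revPrefix β n) :=
  (le_total m n).imp (revPrefix_suffix β) (revPrefix_suffix β)

end Compatible

section Decoding

variable {κ : List Bool → ℕ} {α β : ℕ → Bool} {n r t : ℕ}

theorem Block.suffix_owner {z p : List Bool} {m : ℕ} (h : Block κ z p m) (hm : m + 1 ≤ t)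
    {d : Cell} (hd : d ∈ cells κ t) (hp : Compatible d.2 p) : z <:+ d.1 := by
  obtain ⟨e, he, h1, h2⟩ := exists_cell_of_le hm hd
  exact (h.2 e he (hp.of_suffix_left h2)).trans h1

/-- A decided bit is correct. -/
theorem eq_of_determined {k m : ℕ} (hB : Block κ (revPrefix α (n + 1)) (revPrefix β k) m)
    {b : Bool} (h : Determined (cells κ t) (revPrefix β r) (b :: revPrefix α n)) : b = α n := by
  -- At a stage late enough for both hypotheses, the cell on the branch `β` has an owner extending
  -- both candidate prefixes, which have equal length.
  obtain ⟨c, hc, hβ⟩ := exists_cell_revPrefix (κ := κ) β (max t (m + 1))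
  obtain ⟨d, hd, h1, h2⟩ := exists_cell_of_le (le_max_left t (m + 1)) hc
  have hcomp : ∀ j, Compatible c.2 (revPrefix β j) := fun j => by
    rw [← hβ]
    exact compatible_revPrefix β _ j
  have h3 := ((h d hd).resolve_left
    (not_not.2 ((hcomp r).of_suffix_left h2))).trans h1
  have h4 := hB.suffix_owner (le_max_right t (m + 1)) hc (hcomp k)
  have h5 : b :: revPrefix α n = revPrefix α (n + 1) := by
    rcases suffix_or_suffix h3 h4 with h | h
    · exact h.eq_of_length (by simp)
    · exact (h.eq_of_length (by simp)).symm
  exact (List.cons.inj h5).1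

/-- If the next bit is undecided because of the cells of a proper extension, then no block of a
longer prefix has been read completely. -/
theorem lt_of_undecided {N k m : ℕ} (hN : n < N)
    (hB : Block κ (revPrefix α N) (revPrefix β k) m)
    (hdet : ∀ b, ¬ Determined (cells κ t) (revPrefix β r) (b :: revPrefix α n))
    (hund : Undecided (cells κ t) (revPrefix β r) (revPrefix α n)) : r < k := by
  by_contra! hk
  have hpq := revPrefix_suffix β hk
  -- If the block has been handed over, it forces the bit `α n`. If not, it still lies in a single
  -- cell at stage `t`; this is the only compatible one, and its owner properly extends the output,
  -- so the next bit is determined as well.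
  rcases Nat.lt_or_ge m t with hm | hm
  · refine hdet (α n) fun d hd => or_iff_not_imp_left.2 fun hc => ?_
    exact (revPrefix_suffix α hN).trans
      (hB.suffix_owner hm hd ((not_not.1 hc).of_suffix_right hpq))
  · obtain ⟨c, hc, hcp, -⟩ := hB.1
    obtain ⟨c₀, hc₀, -, h0⟩ := exists_cell_of_le hm hc
    have hI := cellInvariant_cells (κ := κ) t
    have huniq : ∀ d ∈ cells κ t, Compatible d.2 (revPrefix β r) → d = c₀ := by
      intro d hd hcomp
      rcases hcomp.of_suffix_right (h0.trans (hcp.trans hpq)) with h | h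
      · exact hI.prefixFree d hd c₀ hc₀ h
      · exact (hI.prefixFree c₀ hc₀ d hd h).symm
    obtain ⟨d, hd, hcomp, ⟨s, hs⟩, hne⟩ := hund
    rcases List.eq_nil_or_concat s with rfl | ⟨s', b, rfl⟩
    · exact hne hs.symm
    · refine hdet b fun e he => or_iff_not_imp_left.2 fun hc => ?_
      rw [huniq e he (not_not.1 hc), ← huniq d hd hcomp]
      exact ⟨s', by simpa using hs⟩

/-- Guarantees progress: once the block of the next prefix is allocated, the decoder no longer
advances the stage before writing. -/
theorem undecided_of_le {k m : ℕ} (hB : Block κ (revPrefix α (n + 1)) (revPrefix β k) m)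
    (hm : m + 1 ≤ t) : Undecided (cells κ t) (revPrefix β r) (revPrefix α n) := by
  obtain ⟨c, hc, hβ⟩ := exists_cell_revPrefix (κ := κ) β t
  have hcomp : ∀ j, Compatible c.2 (revPrefix β j) := fun j => by
    rw [← hβ]
    exact compatible_revPrefix β _ j
  have h := hB.suffix_owner hm hc (hcomp k)
  refine ⟨c, hc, hcomp r, (List.suffix_cons _ _).trans h, fun heq => ?_⟩
  have := h.length_le
  rw [heq] at this
  simp at this

def decoderConfig (α β : ℕ → Bool) (n r t : ℕ) : OracleMachine.Config :=
  ⟨encode ((revPrefix α n, revPrefix β r, t) : DecoderState), r, bitPrefix α n⟩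

theorem bitPrefix_succ (α : ℕ → Bool) (n : ℕ) : bitPrefix α (n + 1) = bitPrefix α n ++ [α n] := by
  simp [bitPrefix, List.range_succ]

variable {hκ : Computable κ} {k m : ℕ → ℕ}

theorem step_decoder (hB : ∀ n, 0 < n → Block κ (revPrefix α n) (revPrefix β (k n)) (m n))
    (n r t : ℕ) :
    (decoder κ hκ).step β (decoderConfig α β n r t) = decoderConfig α β (n + 1) r t ∨
    ((decoder κ hκ).step β (decoderConfig α β n r t) = decoderConfig α β n (r + 1) t ∧
      ∀ N > n, r < k N) ∨
    ((decoder κ hκ).step β (decoderConfig α β n r t) = decoderConfig α β n r (t + 1) ∧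
      t < m (n + 1) + 1) := by
  have hB1 := hB (n + 1) n.succ_pos
  have hinstr : (decoder κ hκ).instr (decoderConfig α β n r t).memory =
      action (cells κ t) (revPrefix α n, revPrefix β r, t) := by
    simp [decoder, decoderConfig, decodeState]
  by_cases h1 : Determined (cells κ t) (revPrefix β r) (true :: revPrefix α n)
  · left
    have hb := eq_of_determined hB1 h1
    rw [OracleMachine.step, hinstr, action, if_pos h1]
    simp [decoderConfig, bitPrefix_succ, revPrefix, ← hb]
  by_cases h2 : Determined (cells κ t) (revPrefix β r) (false :: revPrefix α n)
  · left
    have hb := eq_of_determined hB1 h2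
    rw [OracleMachine.step, hinstr, action, if_neg h1, if_pos h2]
    simp [decoderConfig, bitPrefix_succ, revPrefix, ← hb]
  right
  by_cases h3 : Undecided (cells κ t) (revPrefix β r) (revPrefix α n)
  · left
    constructor
    · rw [OracleMachine.step, hinstr, action, if_neg h1, if_neg h2, if_pos h3]
      cases hb : β r <;> simp [decoderConfig, revPrefix, hb]
    · intro N hN
      exact lt_of_undecided hN (hB N (by omega)) (by rintro (_ | _) <;> assumption) h3
  · right
    constructor
    · rw [OracleMachine.step, hinstr, action, if_neg h1, if_neg h2, if_neg h3]
      rfl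
    · by_contra! h
      exact h3 (undecided_of_le hB1 h)

theorem run_decoder (hB : ∀ n, 0 < n → Block κ (revPrefix α n) (revPrefix β (k n)) (m n))
    (s : ℕ) : ∃ n r t, (decoder κ hκ).run β s = decoderConfig α β n r t ∧ ∀ N > n, r ≤ k N := by
  induction s with
  | zero => exact ⟨0, 0, 0, rfl, fun _ _ => Nat.zero_le _⟩
  | succ s ih =>
    obtain ⟨n, r, t, h, hr⟩ := ih
    rw [OracleMachine.run, h]
    rcases step_decoder (hκ := hκ) hB n r t with h | ⟨h, h'⟩ | ⟨h, -⟩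
    · exact ⟨n + 1, r, t, h, fun N hN => hr N (by omega)⟩
    · exact ⟨n, r + 1, t, h, h'⟩
    · exact ⟨n, r, t + 1, h, hr⟩

/-- `v` bounds the stages and reads that can still occur before the next bit; every step that does
not write lowers it. -/
theorem exists_run_decoder_succ
    (hB : ∀ n, 0 < n → Block κ (revPrefix α n) (revPrefix β (k n)) (m n)) :
    ∀ v s n r t, (m (n + 1) + 1 - t) + (k (n + 1) - r) = v →
      (decoder κ hκ).run β s = decoderConfig α β n r t →
      ∃ s' r' t', (decoder κ hκ).run β s' = decoderConfig α β (n + 1) r' t' := by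
  intro v
  induction v using Nat.strong_induction_on with
  | _ v ih =>
    intro s n r t hv hs
    have hrun : (decoder κ hκ).run β (s + 1) =
        (decoder κ hκ).step β (decoderConfig α β n r t) := by rw [OracleMachine.run, hs]
    rcases step_decoder (hκ := hκ) hB n r t with h | ⟨h, h'⟩ | ⟨h, h'⟩
    · exact ⟨s + 1, r, t, hrun.trans h⟩
    · have := h' (n + 1) (Nat.lt_succ_self n)
      exact ih _ (by omega) (s + 1) n (r + 1) t rfl (hrun.trans h)
    · exact ih _ (by omega) (s + 1) n r (t + 1) rfl (hrun.trans h)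

theorem computes_decoder
    (hB : ∀ n, 0 < n → Block κ (revPrefix α n) (revPrefix β (k n)) (m n)) :
    (decoder κ hκ).Computes β α := by
  have key : ∀ n, ∃ s r t, (decoder κ hκ).run β s = decoderConfig α β n r t := by
    intro n
    induction n with
    | zero => exact ⟨0, 0, 0, rfl⟩
    | succ n ih =>
      obtain ⟨s, r, t, h⟩ := ih
      exact exists_run_decoder_succ hB _ s n r t rfl h
  intro n
  obtain ⟨s, r, t, h⟩ := key n
  exact ⟨s, by rw [h, decoderConfig]⟩

theorem length_output_decoderConfig (α β : ℕ → Bool) (n r t : ℕ) :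
    (decoderConfig α β n r t).output.length = n := by
  simp [decoderConfig, bitPrefix]

theorem hasOracleUse_decoder
    (hB : ∀ n, 0 < n → Block κ (revPrefix α n) (revPrefix β (k n)) (m n)) (n : ℕ) :
    ∃ u, (decoder κ hκ).HasOracleUse β n u ∧ u ≤ k n := by
  obtain ⟨s₀, hs₀⟩ := computes_decoder (hκ := hκ) hB n
  have hne : ∃ s, n ≤ ((decoder κ hκ).run β s).output.length :=
    ⟨s₀, by simp [hs₀, bitPrefix]⟩
  classical
  refine ⟨_, ⟨Nat.find hne, ⟨Nat.find_spec hne, fun s hs => Nat.find_min' hne hs⟩, rfl⟩, ?_⟩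
  have hspec := Nat.find_spec hne
  cases hf : Nat.find hne with
  | zero => exact Nat.zero_le _
  | succ s =>
    rw [hf] at hspec
    have hmin := Nat.find_min hne (m := s) (by omega)
    obtain ⟨n', r, t, h, hr⟩ := run_decoder (hκ := hκ) hB s
    rw [h, length_output_decoderConfig] at hmin
    rw [OracleMachine.run, h] at hspec ⊢
    rcases step_decoder (hκ := hκ) hB n' r t with h | ⟨h, -⟩ | ⟨h, -⟩ <;>
      rw [h, length_output_decoderConfig] at hspec
    · rw [h]
      -- The step that writes bit number `n` reads nothing, and before it fewer than `n` bits were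
      -- written, so the bound on reads applies to `n`.
      exact hr n (by omega)
    · omega
    · omega

end Decoding

/-! ### Conclusion -/

theorem sum_half_pow_le_one {K : List Bool → ℕ}
    (hsum : ∑' x : List Bool, (2 : ENNReal)⁻¹ ^ K x ≤ 1) (F : Finset (List Bool)) :
    ∑ y ∈ F, (1 / 2 : ℝ) ^ K y.reverse ≤ 1 := by
  have h1 : ∑ y ∈ F, (2 : ENNReal)⁻¹ ^ K y.reverse ≤ 1 := by
    rw [← Finset.sum_image (g := List.reverse) (f := fun x => (2 : ENNReal)⁻¹ ^ K x)
      fun a _ b _ h => List.reverse_injective h]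
    exact (ENNReal.sum_le_tsum _).trans hsum
  have h2 : ENNReal.ofReal (∑ y ∈ F, (1 / 2 : ℝ) ^ K y.reverse) =
      ∑ y ∈ F, (2 : ENNReal)⁻¹ ^ K y.reverse := by
    rw [ENNReal.ofReal_sum_of_nonneg fun _ _ => by positivity]
    refine Finset.sum_congr rfl fun y _ => ?_
    rw [ENNReal.ofReal_pow (by norm_num), one_div, ENNReal.ofReal_inv_of_pos (by norm_num)]
    simp
  rw [← h2] at h1
  simpa using h1

theorem mainTheorem3 (K : List Bool → ℕ) (hK : Computable K)
    (hsum : ∑' x : List Bool, (2 : ENNReal)⁻¹ ^ K x ≤ 1) :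
    ∃ M : OracleMachine, ∀ α : ℕ → Bool, ∃ β : ℕ → Bool,
      M.Computes β α ∧
        ∀ n : ℕ, ∃ k : ℕ, M.HasOracleUse β n k ∧ k ≤ K (bitPrefix α n) := by
  have hκ : Computable fun x : List Bool => K x.reverse := hK.comp Computable.list_reverse
  refine ⟨decoder _ hκ, fun α => ?_⟩
  obtain ⟨β, hβ⟩ := exists_oracle (sum_half_pow_le_one hsum) α
  choose! k hk m hm using hβ
  refine ⟨β, computes_decoder hm, fun n => ?_⟩
  rcases Nat.eq_zero_or_pos n with rfl | hn
  -- The empty prefix has no block, but it is already complete at time 0, before any read.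
  · exact ⟨0, ⟨0, ⟨Nat.zero_le _, fun _ _ => Nat.zero_le _⟩, rfl⟩, Nat.zero_le _⟩
  · obtain ⟨u, hu, hle⟩ := hasOracleUse_decoder (hκ := hκ) hm n
    exact ⟨u, hu, hle.trans ((hk n hn).trans_eq (by rw [reverse_revPrefix]))⟩
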